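/- Let $\mathcal{H}\subset\mathbb{Z}^3$ be a non-empty set such that (i) if $(i,j,k)\in\mathcal{H}$, then $(i',j',k')\in\mathcal{H}$ whenever $i\le i'$, $j\le j'$, $k\le k'$; (ii) for any $(i',j',k')\in\mathcal{H}$, the set $\{(i,j,k)\in\mathcal{H} : i\le i',\ j\le j',\ k\le k'\}$ is finite. Put $H_{\mathrm{init}}=\{(a,b,c)\in\mathcal{H} : (a-1,b-1,c-1)\notin\mathcal{H}\}$. Consider arrays $(y_{i,j,k})_{(i,j,k)\in\mathcal{H}}$ satisfying the cube recurrence $$y_{i,j,k}=\frac{\alpha\, y_{i-1,j,k}\,y_{i,j-1,k-1}+\beta\, y_{i,j-1,k}\,y_{i-1,j,k-1}+\gamma\, y_{i,j,k-1}\,y_{i-1,j-1,k}}{y_{i-1,j-1,k-1}}$$ for all $(i,j,k)\in\mathcal{H}\setminus H_{\mathrm{init}}$, with all the denominators $y_{i-1,j-1,k-1}$ nonzero. Then for every $(i,j,k)\in\mathcal{H}$, the entry $y_{i,j,k}$ is a Laurent polynomial with coefficients in $\mathbb{Z}[\alpha,\beta,\gamma]$ in the initial entries $y_{a,b,c}$,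 $(a,b,c)\in H_{\mathrm{init}}$. Precisely: for each $h\in\mathcal{H}$ there is a Laurent polynomial $L_h$ in variables $x_a$, $a\in H_{\mathrm{init}}$, with coefficients in $\mathbb{Z}[\alpha,\beta,\gamma]$, such that (1) in the field of rational functions over $\mathbb{Q}$ in the independent variables $\alpha,\beta,\gamma$ and $x_a$ ($a\in H_{\mathrm{init}}$), there is an array $(y_h)_{h\in\mathcal{H}}$ which satisfies the cube recurrence, has all the denominators nonzero, has initial entries $y_a=x_a$ for $a\in H_{\mathrm{init}}$, and satisfies $y_h=L_h$ for all $h\in\mathcal{H}$; (2) for every field $F$, all $\alpha,\beta,\gamma\in F$, and every array $(y_h)_{h\in\mathcal{H}}$ in $F$ which satisfies the cube recurrence with all the denominators nonzero, $y_h$ is, for every $h\in\mathcal{H}$, the value of $L_h$ at these $\alpha,\beta,\gamma$ and at $x_a=y_a$ ($a\in H_{\mathrm{init}}$). -/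

import Mathlib

noncomputable section

/-- The ring `R[x_i, x_i⁻¹ : i ∈ σ]` of Laurent polynomials in the variables `x_i`, `i : σ`:
finite `R`-linear combinations of the monomials `x^m`, where `m : σ →₀ ℤ`. -/
abbrev MvLaurentPolynomial (σ : Type*) (R : Type*) [CommSemiring R] : Type _ :=
  AddMonoidAlgebra R (σ →₀ ℤ)

/-- The value in a field `F` of a Laurent polynomial `L = ∑ c_m x^m` at the point `x : σ → F`
(all of whose coordinates should be nonzero), with coefficients mapped to `F` by `φ`. -/
def MvLaurentPolynomial.evalAt {σ R F : Type*} [CommSemiring R] [Field F] (φ : R →+* F)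
    (x : σ → F) (L : MvLaurentPolynomial σ R) : F :=
  ∑ m ∈ L.coeff.support, φ (L.coeff m) * m.prod (fun i n => x i ^ n)

/-- The polynomial ring `ℤ[α, β, γ]`; the variables `0, 1, 2` are `α, β, γ`. -/
abbrev CubeCoeff : Type := MvPolynomial (Fin 3) ℤ

/-- The index set `H_init = {(a,b,c) ∈ H : (a-1,b-1,c-1) ∉ H}`. -/
def cubeInit (H : Set (ℤ × ℤ × ℤ)) : Set (ℤ × ℤ × ℤ) :=
  {h | h ∈ H ∧ (h.1 - 1, h.2.1 - 1, h.2.2 - 1) ∉ H}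

/-- `y` is an array indexed by `H` (values of `y` outside `H` are ignored), with entries in the
field `F`, that satisfies the cube recurrence with parameters `α, β, γ`. The entries by which
the recurrence divides are required to be nonzero. (When `H` is upward closed,
all six other indices below are in `H` as soon as `(i-1,j-1,k-1)` is.) -/
structure IsCubeArray {F : Type*} [Field F] (H : Set (ℤ × ℤ × ℤ)) (α β γ : F)
    (y : ℤ × ℤ × ℤ → F) : Prop where
  ne_zero : ∀ i j k : ℤ, (i, j, k) ∈ H → (i - 1, j - 1, k - 1) ∈ H → y (i - 1, j - 1, k - 1) ≠ 0
  recurrence : ∀ i j k : ℤ, (i, j, k) ∈ H → (i - 1, j - 1, k - 1) ∈ H →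
    y (i, j, k) =
      (α * y (i - 1, j, k) * y (i, j - 1, k - 1)
        + β * y (i, j - 1, k) * y (i - 1, j, k - 1)
        + γ * y (i, j, k - 1) * y (i - 1, j - 1, k)) / y (i - 1, j - 1, k - 1)

/-- The field of rational functions in `α, β, γ` and in independent variables `x_h`, one for
each `h ∈ H_init`. -/
abbrev CubeField (H : Set (ℤ × ℤ × ℤ)) : Type :=
  FractionRing (MvPolynomial (cubeInit H) CubeCoeff)

/-- The inclusion of `ℤ[α, β, γ]` in the field of rational functions. -/
def cubeCoeffMap (H : Set (ℤ × ℤ × ℤ)) : CubeCoeff →+* CubeField H :=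
  (algebraMap (MvPolynomial (cubeInit H) CubeCoeff) (CubeField H)).comp MvPolynomial.C

/-- The variable `x_h`, `h ∈ H_init`, as an element of the field of rational functions. -/
def cubeVar (H : Set (ℤ × ℤ × ℤ)) (h : cubeInit H) : CubeField H :=
  algebraMap (MvPolynomial (cubeInit H) CubeCoeff) (CubeField H) (MvPolynomial.X h)

end

/-!
Induction along `H` reduces the theorem to the exactness of one division: in the ring of Laurent
polynomials, `y h` divides the numerator of the recurrence at `h + 1`. Modulo `y h`, the six
instances of the recurrence below `h + 1` that involve `y h`, together with the one at `h`, show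
that this numerator is annihilated by `y (h - e₀) * y (h - e₁) * y (h - e₂)`. So it suffices that
`y (h - eᵢ)` and `y h` are coprime. Pick `j ≠ i` and let `a` be the initial index on the line
through `h` in direction `eⱼ`. Then `y (h - eᵢ)` does not involve `x_a`, whereas
`y h = l * y (h - 1 + eⱼ) + r` is linear in `x_a` with leading coefficient `l * y (h - 1 + eⱼ)`,
`l` being a unit times a power of a parameter. Up to `l`, this coefficient is a neighbour
of `y (h - eᵢ)`, coprime to it by induction. Finally no parameter divides an entry, because the
entries are positive at `x = 1` even if one of `α, β, γ` is set to `0` and the others to `1`.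
-/

noncomputable section

/-- `v` is a nonzerodivisor modulo `u`. Divisibility replaces coprimality here because it needs no
gcds in `A` and is what the exactness of the division calls for. -/
def IsRegularMod {A : Type*} [CommMonoidWithZero A] (v u : A) : Prop := ∀ w, u ∣ v * w → u ∣ w

namespace IsRegularMod

variable {A : Type*} [CommMonoidWithZero A] {u v w : A}

theorem symm [IsCancelMulZero A] (h : IsRegularMod v u) (hu : u ≠ 0) : IsRegularMod u v := by
  rintro w ⟨t, ht⟩
  obtain ⟨s, rfl⟩ := h t ⟨w, ht.symm⟩
  exact ⟨s, mul_left_cancel₀ hu (by rw [ht, mul_left_comm])⟩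

theorem mul (hv : IsRegularMod v u) (hw : IsRegularMod w u) : IsRegularMod (v * w) u :=
  fun t ht => hw t (hv _ (by rwa [← mul_assoc]))

theorem prod {ι : Type*} {s : Finset ι} {f : ι → A} (h : ∀ i ∈ s, IsRegularMod (f i) u) :
    IsRegularMod (∏ i ∈ s, f i) u :=
  Finset.prod_induction f (IsRegularMod · u) (fun _ _ => mul) (fun _ hw => by rwa [one_mul] at hw) h

theorem of_isUnit_left (hv : IsUnit v) : IsRegularMod v u :=
  fun _ => hv.dvd_mul_left.1

theorem of_isUnit_right (hu : IsUnit u) : IsRegularMod v u :=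
  fun _ _ => hu.dvd

theorem of_prime (hu : Prime u) (hv : ¬ u ∣ v) : IsRegularMod v u :=
  fun _ hw => (hu.dvd_or_dvd hw).resolve_left hv

end IsRegularMod

section GradedRing

variable {A S : Type*} [CommRing A] [SetLike S A] [AddSubmonoidClass S A]

theorem mem_graded_of_mul_mem {ι : Type*} [DecidableEq ι] [AddMonoid ι] [IsDomain A] (𝒜 : ι → S)
    [GradedRing 𝒜] {i : ι} {x y : A} (hx : x ≠ 0) (hx0 : x ∈ 𝒜 0) (hxy : x * y ∈ 𝒜 i) :
    y ∈ 𝒜 i := by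
  have key : x * (DirectSum.decompose 𝒜 y i : A) = x * y := by
    rw [← DirectSum.coe_decompose_mul_of_left_mem_zero 𝒜 hx0,
      DirectSum.decompose_of_mem_same 𝒜 hxy]
  rw [← mul_left_cancel₀ hx key]
  exact SetLike.coe_mem _

open DirectSum in
theorem IsRegularMod.add_of_graded (𝒜 : ℤ → S) [GradedRing 𝒜] {z c e : A} (hz : z ∈ 𝒜 0)
    (hc : c ∈ 𝒜 1) (he : e ∈ 𝒜 0) (h : IsRegularMod c z) : IsRegularMod (c + e) z := by
  classical
  rintro w hw
  have dvd_component : ∀ (f : A) (n : ℤ), z ∣ f → z ∣ (decompose 𝒜 f n : A) := by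
    rintro _ n ⟨g, rfl⟩
    exact ⟨_, coe_decompose_mul_of_left_mem_zero 𝒜 hz⟩
  -- the component of `(c + e) * w` of degree `n + 1` is `c * wₙ + e * wₙ₊₁`
  have descend : ∀ n : ℤ, z ∣ (decompose 𝒜 w (n + 1) : A) → z ∣ (decompose 𝒜 w n : A) := by
    intro n hn
    have hcomp := dvd_component _ (1 + n) hw
    rw [add_mul, decompose_add, DirectSum.add_apply, AddMemClass.coe_add,
      coe_decompose_mul_of_left_mem_zero 𝒜 he, coe_decompose_mul_add_of_left_mem 𝒜 hc,
      add_comm 1 n] at hcomp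
    exact h _ ((dvd_add_left (hn.mul_left e)).1 hcomp)
  obtain ⟨N, hN⟩ := Finset.exists_le (decompose 𝒜 w).support
  have dvd_top : z ∣ (decompose 𝒜 w (N + 1) : A) := by
    rw [DFinsupp.notMem_support_iff.1 fun hmem => (hN _ hmem).not_gt (lt_add_one N)]
    exact dvd_zero z
  have dvd_all : ∀ n ≤ N, z ∣ (decompose 𝒜 w n : A) := fun n hn => by
    induction n, hn using Int.leInductionDown with
    | base => exact descend N dvd_top
    | pred n _ ih => exact descend (n - 1) (by rwa [sub_add_cancel])
  rw [← sum_support_decompose 𝒜 w]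
  exact Finset.dvd_sum fun n hn => dvd_all n (hN n hn)

end GradedRing

namespace MvLaurentPolynomial

variable {σ R : Type*} [CommSemiring R]

/-- The inclusion of the coefficients as constant Laurent polynomials. -/
abbrev C : R →+* MvLaurentPolynomial σ R := algebraMap R _

/-- The variable `x_i`. -/
def X (i : σ) : MvLaurentPolynomial σ R := AddMonoidAlgebra.single (Finsupp.single i 1) 1

theorem C_apply (r : R) : (C r : MvLaurentPolynomial σ R) = AddMonoidAlgebra.single 0 r := rfl

theorem isUnit_single_one (m : σ →₀ ℤ) :
    IsUnit (AddMonoidAlgebra.single m 1 : MvLaurentPolynomial σ R) :=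
  .of_mul_eq_one (AddMonoidAlgebra.single (-m) 1) (by
    rw [AddMonoidAlgebra.single_mul_single, add_neg_cancel, one_mul, AddMonoidAlgebra.one_def])

theorem isUnit_X (i : σ) : IsUnit (X i : MvLaurentPolynomial σ R) := isUnit_single_one _

theorem C_dvd_iff {r : R} {f : MvLaurentPolynomial σ R} : C r ∣ f ↔ ∀ m, r ∣ f.coeff m := by
  constructor
  · rintro ⟨g, rfl⟩ m
    exact ⟨g.coeff m, by rw [C_apply, AddMonoidAlgebra.coeff_single_zero_mul]⟩
  · intro h
    rw [← AddMonoidAlgebra.sum_coeff_single f]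
    refine Finset.dvd_sum fun m _ => ?_
    obtain ⟨s, hs⟩ := h m
    exact ⟨AddMonoidAlgebra.single m s, by
      rw [hs, C_apply, AddMonoidAlgebra.single_mul_single, zero_add]⟩

theorem prime_C {R : Type*} [CommRing R] {p : R} (hp : Prime p) :
    Prime (C p : MvLaurentPolynomial σ R) := by
  have : (Ideal.span {p}).IsPrime := (Ideal.span_singleton_prime hp.ne_zero).2 hp
  let reduce := AddMonoidAlgebra.mapRingHom (σ →₀ ℤ) (Ideal.Quotient.mk (Ideal.span {p}))
  have dvd_iff : ∀ f : MvLaurentPolynomial σ R, C p ∣ f ↔ reduce f = 0 := fun f => by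
    rw [C_dvd_iff, ← AddMonoidAlgebra.coeff_inj, DFunLike.ext_iff]
    exact forall_congr' fun m => (Ideal.Quotient.eq_zero_iff_dvd p _).symm
  refine ⟨fun h => hp.ne_zero ?_, fun h => ?_, fun f g h => ?_⟩
  · rwa [C_apply, AddMonoidAlgebra.single_eq_zero] at h
  · refine one_ne_zero (α := MvLaurentPolynomial σ (R ⧸ Ideal.span {p})) ?_
    rw [← map_one reduce, ← dvd_iff]
    exact h.dvd
  · rw [dvd_iff, map_mul, mul_eq_zero] at h
    rwa [dvd_iff, dvd_iff]

/-- The grading of the Laurent polynomials by the degree in the variable `x_i`. -/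
abbrev degreeIn (R : Type*) [CommSemiring R] (i : σ) : ℤ → Submodule R (MvLaurentPolynomial σ R) :=
  AddMonoidAlgebra.gradeBy R (Finsupp.applyAddHom i : (σ →₀ ℤ) →+ ℤ)

/-- The Laurent polynomials in which the variable `x_i` does not occur. -/
abbrev freeOf (R : Type*) [CommSemiring R] (i : σ) : Subalgebra R (MvLaurentPolynomial σ R) :=
  SetLike.GradeZero.subalgebra (degreeIn R i)

theorem X_mem_degreeIn_one (i : σ) : (X i : MvLaurentPolynomial σ R) ∈ degreeIn R i 1 := by
  have := AddMonoidAlgebra.single_mem_gradeBy (R := R)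
    (Finsupp.applyAddHom i : (σ →₀ ℤ) →+ ℤ) (Finsupp.single i 1) 1
  rwa [Finsupp.applyAddHom_apply, Finsupp.single_eq_same] at this

theorem X_mem_freeOf {i j : σ} (h : j ≠ i) : (X j : MvLaurentPolynomial σ R) ∈ freeOf R i := by
  have := AddMonoidAlgebra.single_mem_gradeBy (R := R)
    (Finsupp.applyAddHom i : (σ →₀ ℤ) →+ ℤ) (Finsupp.single j 1) 1
  rwa [Finsupp.applyAddHom_apply, Finsupp.single_eq_of_ne h.symm] at this

theorem mul_mem_degreeIn_one {i : σ} {f g : MvLaurentPolynomial σ R} (hf : f ∈ freeOf R i)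
    (hg : g ∈ degreeIn R i 1) : f * g ∈ degreeIn R i 1 := by
  simpa only [zero_add] using SetLike.mul_mem_graded (A := degreeIn R i) (i := 0) hf hg

/-- The evaluation of Laurent polynomials at a point with nonzero coordinates, as a ring
homomorphism; `evalHom_apply` identifies it with `evalAt`. -/
def evalHom {F : Type*} [Field F] (φ : R →+* F) (x : σ → F) (hx : ∀ i, x i ≠ 0) :
    MvLaurentPolynomial σ R →+* F :=
  AddMonoidAlgebra.liftNCRingHom φ
    { toFun := fun m => (Multiplicative.toAdd m).prod fun i n => x i ^ n
      map_one' := by simp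
      map_mul' := fun m n => Finsupp.prod_add_index' (fun _ => zpow_zero _)
        fun i a b => zpow_add₀ (hx i) a b }
    fun _ _ => Commute.all _ _

section evalHom

variable {F : Type*} [Field F] (φ : R →+* F) {x : σ → F} (hx : ∀ i, x i ≠ 0)

theorem evalHom_single (m : σ →₀ ℤ) (r : R) :
    evalHom φ x hx (AddMonoidAlgebra.single m r) = φ r * m.prod fun i n => x i ^ n :=
  AddMonoidAlgebra.liftNCRingHom_single _ _ _ _ _

theorem evalHom_apply (L : MvLaurentPolynomial σ R) : evalHom φ x hx L = L.evalAt φ x := by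
  conv_lhs => rw [← AddMonoidAlgebra.sum_coeff_single L]
  rw [Finsupp.sum, map_sum]
  exact Finset.sum_congr rfl fun m _ => evalHom_single φ hx m _

theorem evalHom_C (r : R) : evalHom φ x hx (C r) = φ r := by
  rw [C_apply, evalHom_single, Finsupp.prod_zero_index, mul_one]

theorem evalHom_X (i : σ) : evalHom φ x hx (X i) = x i := by
  rw [X, evalHom_single, map_one, one_mul, Finsupp.prod_single_index (zpow_zero _), zpow_one]

/-- The inclusion of the polynomials in the Laurent polynomials. -/
def ofMvPolynomial : MvPolynomial σ R →+* MvLaurentPolynomial σ R :=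
  AddMonoidAlgebra.mapDomainRingHom R (Finsupp.mapRange.addMonoidHom (Nat.castAddMonoidHom ℤ))

theorem ofMvPolynomial_monomial (n : σ →₀ ℕ) (r : R) :
    ofMvPolynomial (MvPolynomial.monomial n r) =
      AddMonoidAlgebra.single (n.mapRange (Nat.cast : ℕ → ℤ) Nat.cast_zero) r :=
  AddMonoidAlgebra.mapDomain_single

theorem exists_ofMvPolynomial_eq_mul (f : MvLaurentPolynomial σ R) :
    ∃ u p : MvPolynomial σ R, IsUnit (ofMvPolynomial u) ∧
      ofMvPolynomial p = ofMvPolynomial u * f := by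
  induction f using AddMonoidAlgebra.induction_linear with
  | zero => exact ⟨1, 0, by simp, by simp⟩
  | add f g hf hg =>
    obtain ⟨u, p, hu, hp⟩ := hf
    obtain ⟨v, q, hv, hq⟩ := hg
    refine ⟨u * v, p * v + q * u, by rw [map_mul]; exact hu.mul hv, ?_⟩
    rw [map_add, map_mul, map_mul, map_mul, hp, hq]
    ring
  | single m r =>
    refine ⟨MvPolynomial.monomial (m.mapRange (fun k => (-k).toNat) rfl) 1,
      MvPolynomial.monomial (m.mapRange Int.toNat rfl) r, ?_, ?_⟩
    · rw [ofMvPolynomial_monomial]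
      exact isUnit_single_one _
    · rw [ofMvPolynomial_monomial, ofMvPolynomial_monomial, AddMonoidAlgebra.single_mul_single,
        one_mul]
      congr 1
      ext i
      simp only [Finsupp.mapRange_apply, Finsupp.add_apply]
      omega

theorem evalHom_ofMvPolynomial (p : MvPolynomial σ R) :
    evalHom φ x hx (ofMvPolynomial p) = MvPolynomial.eval₂Hom φ x p := by
  suffices (evalHom φ x hx).comp ofMvPolynomial = MvPolynomial.eval₂Hom φ x from
    DFunLike.congr_fun this p
  refine MvPolynomial.ringHom_ext (fun r => ?_) fun i => ?_
  · rw [RingHom.comp_apply, MvPolynomial.C_apply, ofMvPolynomial_monomial, Finsupp.mapRange_zero,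
      ← C_apply, evalHom_C, ← MvPolynomial.C_apply, MvPolynomial.eval₂Hom_C]
  · rw [RingHom.comp_apply, MvPolynomial.X, ofMvPolynomial_monomial, Finsupp.mapRange_single,
      Nat.cast_one, ← MvPolynomial.X, MvPolynomial.eval₂Hom_X']
    exact evalHom_X φ hx i

theorem evalHom_injective {R : Type*} [CommRing R] {φ : R →+* F}
    (h : Function.Injective (MvPolynomial.eval₂Hom φ x)) :
    Function.Injective (evalHom φ x hx) := by
  refine (injective_iff_map_eq_zero _).2 fun f hf => ?_
  obtain ⟨u, p, hu, hp⟩ := exists_ofMvPolynomial_eq_mul f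
  have hp0 : p = 0 := (injective_iff_map_eq_zero _).1 h p (by
    rw [← evalHom_ofMvPolynomial φ hx, hp, map_mul, hf, mul_zero])
  rwa [hp0, map_zero, eq_comm, hu.mul_right_eq_zero] at hp

end evalHom

end MvLaurentPolynomial

section Order

variable {α : Type*} [Preorder α] {H : Set α}

theorem isWF_of_finite_inter_Iic (hfin : ∀ h ∈ H, (H ∩ Set.Iic h).Finite) : H.IsWF := by
  refine Set.wellFoundedOn_iff.2 <| Subrelation.wf (r := InvImage (· < ·)
    fun h => (H ∩ Set.Iic h).ncard) ?_ (InvImage.wf _ wellFounded_lt)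
  rintro a b ⟨hab, -, hb⟩
  have hsub : H ∩ Set.Iic a ⊆ H ∩ Set.Iic b :=
    Set.inter_subset_inter_right H (Set.Iic_subset_Iic.2 hab.le)
  exact Set.ncard_lt_ncard
    (Set.ssubset_iff_exists.2 ⟨hsub, b, ⟨hb, le_rfl⟩, fun h => hab.not_ge h.2⟩) (hfin b hb)

theorem exists_eq_step_of_isWF {A : Type*} [Nonempty A] (hwf : H.IsWF)
    (step : (α → A) → α → A) (step_congr : ∀ h ∈ H, ∀ y z : α → A,
      (∀ k ∈ H, k < h → y k = z k) → step y h = step z h) :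
    ∃ y : α → A, ∀ h ∈ H, y h = step y h := by
  classical
  have hlt := Set.wellFoundedOn_iff.1 hwf
  refine ⟨hlt.fix fun h y => step (fun k => if hk : k < h ∧ k ∈ H ∧ h ∈ H then y k hk else
    Classical.arbitrary A) h, fun h hh => ?_⟩
  rw [hlt.fix_eq]
  exact step_congr h hh _ _ fun k hk hkh => dif_pos ⟨hkh, hk, hh⟩

end Order

section Cube

/-- The unit vectors of `ℤ³`. -/
def axis : Fin 3 → ℤ × ℤ × ℤ := ![(1, 0, 0), (0, 1, 0), (0, 0, 1)]

theorem axis_pos (i : Fin 3) : 0 < axis i := by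
  fin_cases i <;> simp [axis, Prod.lt_iff, Prod.le_def]

theorem axis_lt_one (i : Fin 3) : axis i < 1 := by
  fin_cases i <;> simp [axis, Prod.lt_iff]

theorem sub_one_add_axis {i j k : Fin 3} (hij : i ≠ j) (hik : i ≠ k) (hjk : j ≠ k)
    (h : ℤ × ℤ × ℤ) : h - 1 + axis i = h - axis j - axis k := by
  have : axis i + axis j + axis k = 1 := by
    revert i j k; decide
  rw [← this]
  abel

theorem sub_one_add_axis_le {i j : Fin 3} (hij : i ≠ j) (h : ℤ × ℤ × ℤ) :
    h - 1 + axis j ≤ h - axis i := by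
  obtain ⟨k, hki, hkj⟩ := Fin.exists_ne_and_ne_of_two_lt i j (by norm_num)
  rw [sub_one_add_axis hij.symm hkj.symm hki.symm]
  exact sub_le_self _ (axis_pos k).le

theorem not_axis_le_smul {i j : Fin 3} (hij : i ≠ j) (s : ℤ) : ¬ axis i ≤ s • axis j := by
  fin_cases i <;> fin_cases j <;> simp_all [axis, Prod.le_def]

/-- The right-hand side of the cube recurrence at `h`, with coefficients `c`. The index
`h - 1 + axis 0` is the `(i, j - 1, k - 1)` of the recurrence. -/
def cubeNum {A : Type*} [CommSemiring A] (c : Fin 3 → A) (y : ℤ × ℤ × ℤ → A) (h : ℤ × ℤ × ℤ) : A :=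
  ∑ i, c i * y (h - axis i) * y (h - 1 + axis i)

theorem sub_axis_lt (h : ℤ × ℤ × ℤ) (i : Fin 3) : h - axis i < h := sub_lt_self h (axis_pos i)

theorem sub_one_add_axis_lt (h : ℤ × ℤ × ℤ) (i : Fin 3) : h - 1 + axis i < h := by
  rw [sub_add, sub_lt_self_iff, sub_pos]
  exact axis_lt_one i

theorem sub_one_le_sub_axis (h : ℤ × ℤ × ℤ) (i : Fin 3) : h - 1 ≤ h - axis i :=
  sub_le_sub_left (axis_lt_one i).le h

theorem sub_one_le_sub_one_add_axis (h : ℤ × ℤ × ℤ) (i : Fin 3) : h - 1 ≤ h - 1 + axis i :=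
  le_add_of_nonneg_right (axis_pos i).le

theorem sub_one_lt_self (h : ℤ × ℤ × ℤ) : h - 1 < h :=
  sub_lt_self h ((axis_pos 0).trans (axis_lt_one 0))

theorem cubeNum_congr {A : Type*} [CommSemiring A] (c : Fin 3 → A) {y z : ℤ × ℤ × ℤ → A}
    {h : ℤ × ℤ × ℤ} (hyz : ∀ k, h - 1 ≤ k → k < h → y k = z k) :
    cubeNum c y h = cubeNum c z h :=
  Finset.sum_congr rfl fun i _ => by
    rw [hyz _ (sub_one_le_sub_axis h i) (sub_axis_lt h i),
      hyz _ (sub_one_le_sub_one_add_axis h i) (sub_one_add_axis_lt h i)]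

theorem map_cubeNum {A B : Type*} [CommSemiring A] [CommSemiring B] (f : A →+* B) (c : Fin 3 → A)
    (y : ℤ × ℤ × ℤ → A) (h : ℤ × ℤ × ℤ) :
    f (cubeNum c y h) = cubeNum (f ∘ c) (f ∘ y) h := by
  simp only [cubeNum, map_sum, map_mul, Function.comp_apply]

/-- The array `y` satisfies the cube recurrence, with the denominators cleared, at the indices in
`D`. Exactness of the division at `h` is proved while the recurrence is known only for `D = Iio h`.
-/
def IsCubeOn {A : Type*} [CommSemiring A] (H D : Set (ℤ × ℤ × ℤ)) (c : Fin 3 → A)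
    (y : ℤ × ℤ × ℤ → A) : Prop :=
  ∀ h ∈ D, h - 1 ∈ H → y h * y (h - 1) = cubeNum c y h

theorem IsCubeOn.map {A B : Type*} [CommSemiring A] [CommSemiring B] {H D : Set (ℤ × ℤ × ℤ)}
    {c : Fin 3 → A} {y : ℤ × ℤ × ℤ → A} (hy : IsCubeOn H D c y) (f : A →+* B) :
    IsCubeOn H D (f ∘ c) (f ∘ y) := fun h hD hh => by
  rw [← map_cubeNum, ← hy h hD hh, map_mul, Function.comp_apply, Function.comp_apply]

variable {H : Set (ℤ × ℤ × ℤ)}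

theorem cube_induction (hup : IsUpperSet H) (hwf : H.IsWF) {P : ℤ × ℤ × ℤ → Prop}
    (init : ∀ h ∈ cubeInit H, P h)
    (step : ∀ h, h - 1 ∈ H → (∀ k, h - 1 ≤ k → k < h → P k) → P h) : ∀ h ∈ H, P h := by
  intro h hh
  refine Set.WellFoundedOn.induction hwf hh fun h hh ih => ?_
  by_cases h1 : h - 1 ∈ H
  · exact step h h1 fun k hk hkh => ih k (hup hk h1) hkh
  · exact init h ⟨hh, h1⟩

theorem isCubeArray_iff {F : Type*} [Field F] (hup : IsUpperSet H) {α β γ : F}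
    {y : ℤ × ℤ × ℤ → F} :
    IsCubeArray H α β γ y ↔
      (∀ h ∈ H, y h ≠ 0) ∧ IsCubeOn H Set.univ ![α, β, γ] y := by
  have sub_one : ∀ i j k : ℤ, ((i, j, k) : ℤ × ℤ × ℤ) - 1 = (i - 1, j - 1, k - 1) :=
    fun _ _ _ => rfl
  have cubeNum_eq : ∀ i j k, cubeNum ![α, β, γ] y (i, j, k) =
      α * y (i - 1, j, k) * y (i, j - 1, k - 1) + β * y (i, j - 1, k) * y (i - 1, j, k - 1)
        + γ * y (i, j, k - 1) * y (i - 1, j - 1, k) := fun i j k => by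
    simp [cubeNum, axis, Fin.sum_univ_three, sub_one]
  constructor
  · intro hy
    have ne_zero : ∀ h ∈ H, y h ≠ 0 := by
      rintro ⟨i, j, k⟩ hh
      have := hy.ne_zero (i + 1) (j + 1) (k + 1) (hup (by simp [Prod.le_def]) hh)
      simp only [add_sub_cancel_right] at this
      exact this hh
    refine ⟨ne_zero, ?_⟩
    rintro ⟨i, j, k⟩ - hh
    rw [cubeNum_eq, ← eq_div_iff (ne_zero _ hh)]
    exact hy.recurrence i j k (hup (sub_one_lt_self _).le hh) hh
  · rintro ⟨ne_zero, hy⟩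
    refine ⟨fun i j k _ hh => ne_zero _ hh, fun i j k _ hh => ?_⟩
    rw [eq_div_iff (ne_zero _ hh), ← cubeNum_eq]
    exact hy (i, j, k) trivial hh

theorem exists_cube_of_dvd (hup : IsUpperSet H) (hwf : H.IsWF) {A : Type*} [CommSemiring A]
    (c : Fin 3 → A) (x : cubeInit H → A) :
    ∃ y : ℤ × ℤ × ℤ → A, (∀ a : cubeInit H, y a = x a) ∧ ∀ h, h - 1 ∈ H →
      y (h - 1) ∣ cubeNum c y h → y h * y (h - 1) = cubeNum c y h := by
  classical
  let step : (ℤ × ℤ × ℤ → A) → ℤ × ℤ × ℤ → A := fun y h =>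
    if ha : h ∈ cubeInit H then x ⟨h, ha⟩ else
      Classical.epsilon fun q => q * y (h - 1) = cubeNum c y h
  have step_congr : ∀ h ∈ H, ∀ y z : ℤ × ℤ × ℤ → A, (∀ k ∈ H, k < h → y k = z k) →
      step y h = step z h := fun h hh y z hyz => by
    by_cases ha : h ∈ cubeInit H
    · simp only [step, dif_pos ha]
    · have h1 : h - 1 ∈ H := by_contra fun h1 => ha ⟨hh, h1⟩
      simp only [step, dif_neg ha]
      rw [hyz _ h1 (sub_one_lt_self h), cubeNum_congr c fun k hk hkh => hyz k (hup hk h1) hkh]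
  obtain ⟨y, hy⟩ := exists_eq_step_of_isWF hwf step step_congr
  refine ⟨y, fun a => (hy a a.2.1).trans (dif_pos a.2), fun h h1 ⟨q, hq⟩ => ?_⟩
  rw [hy h (hup (sub_one_lt_self h).le h1)]
  simp only [step, dif_neg fun ha : h ∈ cubeInit H => ha.2 h1]
  exact Classical.epsilon_spec (p := fun q => q * y (h - 1) = cubeNum c y h)
    ⟨q, by rw [hq, mul_comm]⟩

theorem sum_eq_of_ne {B : Type*} [AddCommMonoid B] (f : Fin 3 → B) {i j k : Fin 3} (hij : i ≠ j)
    (hik : i ≠ k) (hjk : j ≠ k) : ∑ l, f l = f i + f j + f k := by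
  have : (Finset.univ : Finset (Fin 3)) = {i, j, k} := by
    revert i j k; decide
  rw [this, Finset.sum_insert (by simp [hij, hik]), Finset.sum_pair hjk, add_assoc]

theorem prod_mul_sum_eq_zero {B : Type*} [CommRing B] {c P Q M S : Fin 3 → B}
    {T : Fin 3 → Fin 3 → B}
    (hP : ∀ i j k, i ≠ j → i ≠ k → j ≠ k → P i * S i = c j * T i j * M k + c k * T i k * M j)
    (hQ : ∀ i j k, i ≠ j → i ≠ k → j ≠ k → Q i * M i = c j * P k * T j i + c k * P j * T k i)
    (h0 : ∑ i, c i * M i * S i = 0) : (∏ i, M i) * ∑ i, c i * Q i * P i = 0 := by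
  simp only [Fin.sum_univ_three, Fin.prod_univ_three] at h0 ⊢
  linear_combination
    c 0 * P 0 * M 1 * M 2 * hQ 0 1 2 (by decide) (by decide) (by decide)
      + c 1 * P 1 * M 0 * M 2 * hQ 1 0 2 (by decide) (by decide) (by decide)
      + c 2 * P 2 * M 0 * M 1 * hQ 2 0 1 (by decide) (by decide) (by decide)
      - c 0 * P 1 * P 2 * M 0 * hP 0 1 2 (by decide) (by decide) (by decide)
      - c 1 * P 0 * P 2 * M 1 * hP 1 0 2 (by decide) (by decide) (by decide)
      - c 2 * P 0 * P 1 * M 2 * hP 2 0 1 (by decide) (by decide) (by decide)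
      + P 0 * P 1 * P 2 * h0

namespace IsCubeOn

theorem pos {K : Type*} [CommSemiring K] [LinearOrder K] [IsStrictOrderedRing K]
    {D : Set (ℤ × ℤ × ℤ)} {c : Fin 3 → K} {y : ℤ × ℤ × ℤ → K} (hup : IsUpperSet H) (hwf : H.IsWF)
    (hD : IsLowerSet D) (hy : IsCubeOn H D c y) (hc : ∀ i, 0 ≤ c i) (hc' : ∃ i, 0 < c i)
    (init : ∀ h ∈ cubeInit H, 0 < y h) : ∀ h ∈ H, h ∈ D → 0 < y h := by
  refine cube_induction hup hwf (fun h hh _ => init h hh) fun h h1 ih hhD => ?_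
  have ih' : ∀ k, h - 1 ≤ k → k < h → 0 < y k := fun k hk hkh => ih k hk hkh (hD hkh.le hhD)
  have hN : 0 < cubeNum c y h := by
    have hfac : ∀ i, 0 < y (h - axis i) * y (h - 1 + axis i) := fun i =>
      mul_pos (ih' _ (sub_one_le_sub_axis h i) (sub_axis_lt h i))
        (ih' _ (sub_one_le_sub_one_add_axis h i) (sub_one_add_axis_lt h i))
    obtain ⟨i, hi⟩ := hc'
    simp only [cubeNum, mul_assoc]
    exact Finset.sum_pos' (fun j _ => mul_nonneg (hc j) (hfac j).le)
      ⟨i, Finset.mem_univ i, mul_pos hi (hfac i)⟩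
  rw [← hy h hhD h1] at hN
  exact pos_of_mul_pos_left hN (ih' _ le_rfl (sub_one_lt_self h)).le

theorem eq_of_eq_init {A : Type*} [CommSemiring A] [IsCancelMulZero A] {c : Fin 3 → A}
    {y z : ℤ × ℤ × ℤ → A} (hup : IsUpperSet H) (hwf : H.IsWF) (hy : IsCubeOn H Set.univ c y)
    (hz : IsCubeOn H Set.univ c z) (hy0 : ∀ h ∈ H, y h ≠ 0)
    (init : ∀ h ∈ cubeInit H, y h = z h) : ∀ h ∈ H, y h = z h := by
  refine cube_induction hup hwf init fun h h1 ih => mul_right_cancel₀ (hy0 _ h1) ?_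
  rw [hy h trivial h1, cubeNum_congr c ih, ← hz h trivial h1, ih _ le_rfl (sub_one_lt_self h)]

theorem prod_mul_cubeNum_eq_zero {B : Type*} [CommRing B] {D : Set (ℤ × ℤ × ℤ)} {c : Fin 3 → B}
    {y : ℤ × ℤ × ℤ → B} (hup : IsUpperSet H) (hy : IsCubeOn H D c y) {h : ℤ × ℤ × ℤ}
    (hD : Set.Iio (h + 1) ⊆ D) (h1 : h - 1 ∈ H) (h0 : y h = 0) :
    (∏ i, y (h - axis i)) * cubeNum c y (h + 1) = 0 := by
  have mem_H : ∀ {k}, h - 1 ≤ k → k ∈ H := fun hk => hup hk h1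
  unfold cubeNum
  rw [add_sub_cancel_right]
  refine prod_mul_sum_eq_zero (S := fun i => y (h - 1 + axis i))
    (T := fun i j => y (h + axis i - axis j)) ?_ ?_ ?_
  · intro i j k hij hik hjk
    have e := hy (h + axis i) (hD (add_lt_add_right (axis_lt_one i) h))
      (mem_H (sub_le_sub_right (le_add_of_nonneg_right (axis_pos i).le) 1))
    rw [cubeNum, sum_eq_of_ne _ hij hik hjk, sub_one_add_axis hij.symm hjk hik,
      sub_one_add_axis hik.symm hjk.symm hij, add_sub_cancel_right, h0] at e
    rw [add_sub_right_comm] at e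
    linear_combination e
  · intro i j k hij hik hjk
    have shift : h + 1 - axis i - 1 = h - axis i := by abel
    have e := hy (h + 1 - axis i) (hD (sub_axis_lt _ i))
      (shift ▸ mem_H (sub_one_le_sub_axis h i))
    rw [cubeNum, sum_eq_of_ne _ hij hik hjk, ← sub_one_add_axis hik.symm hjk.symm hij,
      ← sub_one_add_axis hij.symm hjk hik, shift, add_sub_cancel_right, sub_add_cancel, h0] at e
    rw [add_sub_right_comm _ (axis j), add_sub_right_comm _ (axis k)]
    linear_combination e
  · change cubeNum c y h = 0
    rw [← hy h (hD (lt_add_of_pos_right h zero_lt_one)) h1, h0, zero_mul]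

end IsCubeOn

end Cube

section LaurentPhenomenon

open MvLaurentPolynomial

variable {H D : Set (ℤ × ℤ × ℤ)} {R : Type*} [CommRing R] {c : Fin 3 → R}
  {y : ℤ × ℤ × ℤ → MvLaurentPolynomial (cubeInit H) R}

/-- `y` solves the cube recurrence on the lower set `D` in the Laurent polynomials, with the
variables as initial entries, and none of its entries in `D` shares a factor with a coefficient of
the recurrence. -/
structure IsLaurentCube (H D : Set (ℤ × ℤ × ℤ)) (c : Fin 3 → R)
    (y : ℤ × ℤ × ℤ → MvLaurentPolynomial (cubeInit H) R) : Prop where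
  upper : IsUpperSet H
  wf : H.IsWF
  lower : IsLowerSet D
  initial : ∀ a : cubeInit H, y a = X a
  isCubeOn : IsCubeOn H D (C ∘ c) y
  ne_zero : ∀ h ∈ H, h ∈ D → y h ≠ 0
  regular : ∀ h ∈ H, h ∈ D → ∀ i, IsRegularMod (C (c i)) (y h)

namespace IsLaurentCube

theorem isUnit_of_mem_cubeInit (hy : IsLaurentCube H D c y) {h : ℤ × ℤ × ℤ}
    (hh : h ∈ cubeInit H) : IsUnit (y h) :=
  (hy.initial ⟨h, hh⟩).symm ▸ isUnit_X _

theorem mem_freeOf [IsDomain R] (hy : IsLaurentCube H D c y) (a : cubeInit H) :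
    ∀ h ∈ H, h ∈ D → ¬ (a : ℤ × ℤ × ℤ) ≤ h → y h ∈ freeOf R a := by
  refine cube_induction hy.upper hy.wf (fun h hh _ hah => ?_) fun h h1 ih hD hah => ?_
  · rw [hy.initial ⟨h, hh⟩]
    exact X_mem_freeOf fun e => hah (e ▸ le_rfl)
  · have ih' : ∀ k, h - 1 ≤ k → k < h → y k ∈ freeOf R a := fun k hk hkh =>
      ih k hk hkh (hy.lower hkh.le hD) fun hak => hah (hak.trans hkh.le)
    refine mem_graded_of_mul_mem (degreeIn R a)
      (hy.ne_zero _ h1 (hy.lower (sub_one_lt_self h).le hD)) (ih' _ le_rfl (sub_one_lt_self h)) ?_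
    rw [mul_comm, hy.isCubeOn h hD h1]
    exact (freeOf R a).sum_mem fun i _ => mul_mem (mul_mem (algebraMap_mem _ _)
      (ih' _ (sub_one_le_sub_axis h i) (sub_axis_lt h i)))
      (ih' _ (sub_one_le_sub_one_add_axis h i) (sub_one_add_axis_lt h i))

theorem exists_leadingCoeff_of_mem_cubeInit [IsDomain R] (hy : IsLaurentCube H D c y)
    {h k : ℤ × ℤ × ℤ} (hh : h ∈ cubeInit H) (hk : k ∈ cubeInit H) (hkD : k ∈ D) (hkh : k < h) :
    ∃ l ∈ degreeIn R (⟨h, hh⟩ : cubeInit H) 1, IsUnit l ∧ y h = l * y k := by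
  have hkfree := hy.mem_freeOf ⟨h, hh⟩ k hk.1 hkD hkh.not_ge
  obtain ⟨w, hw⟩ := (hy.isUnit_of_mem_cubeInit hk).exists_right_inv
  have hwfree : w ∈ freeOf R (⟨h, hh⟩ : cubeInit H) :=
    mem_graded_of_mul_mem (degreeIn R _) (hy.ne_zero k hk.1 hkD) hkfree (hw ▸ one_mem (freeOf R _))
  refine ⟨w * X ⟨h, hh⟩, mul_mem_degreeIn_one hwfree (X_mem_degreeIn_one _),
    (IsUnit.of_mul_eq_one_right _ hw).mul (isUnit_X _), ?_⟩
  rw [hy.initial ⟨h, hh⟩]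
  linear_combination -X ⟨h, hh⟩ * hw

theorem sub_leadingCoeff_mul_mem_freeOf [IsDomain R] (hy : IsLaurentCube H D c y)
    {h : ℤ × ℤ × ℤ} (h1 : h - 1 ∈ H) (hD : h ∈ D) {a : cubeInit H} {j : Fin 3} {s : ℤ}
    (ha : (a : ℤ × ℤ × ℤ) = h - s • axis j) {l : MvLaurentPolynomial (cubeInit H) R}
    (hl : y (h - axis j) - l * y (h - 1) ∈ freeOf R a) :
    y h - C (c j) * l * y (h - 1 + axis j) ∈ freeOf R a := by
  have free : ∀ {k i}, i ≠ j → h - 1 ≤ k → k ≤ h - axis i → y k ∈ freeOf R a :=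
    fun {k i} hij hk hki => hy.mem_freeOf a k (hy.upper hk h1)
      (hy.lower (hki.trans (sub_axis_lt h i).le) hD) fun hak =>
        not_axis_le_smul hij s ((sub_le_sub_iff_left h).1 (ha ▸ hak.trans hki))
  have hrest : ∑ i ∈ Finset.univ.erase j, C (c i) * y (h - axis i) * y (h - 1 + axis i) ∈
      freeOf R a := (freeOf R a).sum_mem fun i hi => by
    have hij := Finset.ne_of_mem_erase hi
    obtain ⟨k, hki, hkj⟩ := Fin.exists_ne_and_ne_of_two_lt i j (by norm_num)
    exact mul_mem (mul_mem (algebraMap_mem _ _) (free hij (sub_one_le_sub_axis h i) le_rfl))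
      (free hkj (sub_one_le_sub_one_add_axis h i) (sub_one_add_axis_le hki h))
  obtain ⟨i, hij⟩ := exists_ne j
  refine mem_graded_of_mul_mem (degreeIn R a)
    (hy.ne_zero _ h1 (hy.lower (sub_one_lt_self h).le hD))
    (free hij le_rfl (sub_one_le_sub_axis h i)) ?_
  have hcube : y h * y (h - 1) = C (c j) * y (h - axis j) * y (h - 1 + axis j) +
      ∑ i ∈ Finset.univ.erase j, C (c i) * y (h - axis i) * y (h - 1 + axis i) :=
    (hy.isCubeOn h hD h1).trans (Finset.add_sum_erase _ _ (Finset.mem_univ j)).symm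
  have key : y (h - 1) * (y h - C (c j) * l * y (h - 1 + axis j)) =
      C (c j) * y (h - 1 + axis j) * (y (h - axis j) - l * y (h - 1)) +
        ∑ i ∈ Finset.univ.erase j, C (c i) * y (h - axis i) * y (h - 1 + axis i) := by
    linear_combination hcube
  have hjfree := free hij (sub_one_le_sub_one_add_axis h j) (sub_one_add_axis_le hij h)
  rw [key]
  exact (freeOf R a).add_mem (mul_mem (mul_mem (algebraMap_mem _ _) hjfree) hl) hrest

/-- The entry `y h` is linear in the initial variable on the line through `h` along `axis j`: among
the factors of the right-hand side of the recurrence at `h`, only `y (h - axis j)` contains it. -/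
theorem exists_leadingCoeff [IsDomain R] (hy : IsLaurentCube H D c y) (j : Fin 3) :
    ∀ h ∈ H, h ∈ D → h - 1 + axis j ∈ H → ∃ a : cubeInit H,
      (∃ s : ℤ, (a : ℤ × ℤ × ℤ) = h - s • axis j) ∧ ∃ l ∈ degreeIn R a 1,
        (∀ k ∈ H, k ∈ D → IsRegularMod l (y k)) ∧ y h - l * y (h - 1 + axis j) ∈ freeOf R a := by
  refine cube_induction hy.upper hy.wf (fun h hh hD hjH => ?_) fun h h1 ih hD _ => ?_
  · have hjh := sub_one_add_axis_lt h j
    have hj : h - 1 + axis j ∈ cubeInit H :=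
      ⟨hjH, fun h2 => hh.2 (hy.upper (sub_le_sub_right hjh.le 1) h2)⟩
    obtain ⟨l, hl, hlunit, hlh⟩ :=
      hy.exists_leadingCoeff_of_mem_cubeInit hh hj (hy.lower hjh.le hD) hjh
    exact ⟨⟨h, hh⟩, ⟨0, by rw [zero_smul, sub_zero]⟩, l, hl, fun _ _ _ => .of_isUnit_left hlunit,
      by rw [hlh, sub_self]; exact zero_mem _⟩
  · obtain ⟨a, ⟨s, hs⟩, l, hl, hlreg, hlfree⟩ := ih (h - axis j) (sub_one_le_sub_axis h j)
      (sub_axis_lt h j) (hy.lower (sub_axis_lt h j).le hD)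
      (by rwa [sub_right_comm, sub_add_cancel])
    rw [sub_right_comm h, sub_add_cancel] at hlfree
    have ha : (a : ℤ × ℤ × ℤ) = h - (s + 1) • axis j := by rw [hs, add_smul, one_smul]; abel
    exact ⟨a, ⟨s + 1, ha⟩, C (c j) * l, mul_mem_degreeIn_one (algebraMap_mem _ _) hl,
      fun k hk hkD => (hy.regular k hk hkD j).mul (hlreg k hk hkD),
      hy.sub_leadingCoeff_mul_mem_freeOf h1 hD ha hlfree⟩

theorem isRegularMod_sub_axis [IsDomain R] (hy : IsLaurentCube H D c y) :
    ∀ h ∈ H, h ∈ D → ∀ i, h - axis i ∈ H → IsRegularMod (y (h - axis i)) (y h) := by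
  refine cube_induction hy.upper hy.wf (fun h hh _ i _ => ?_) fun h h1 ih hD i hi => ?_
  · exact .of_isUnit_right (hy.isUnit_of_mem_cubeInit hh)
  · obtain ⟨j, hji⟩ := exists_ne i
    obtain ⟨k, hki, hkj⟩ := Fin.exists_ne_and_ne_of_two_lt i j (by norm_num)
    have hiD := hy.lower (sub_axis_lt h i).le hD
    have hikH : h - axis i - axis k ∈ H :=
      hy.upper (sub_one_add_axis hji hkj.symm hki.symm h ▸ sub_one_le_sub_one_add_axis h j) h1
    obtain ⟨a, ⟨s, hs⟩, l, hl, hlreg, hlfree⟩ := hy.exists_leadingCoeff j h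
      (hy.upper (sub_one_lt_self h).le h1) hD (by rwa [sub_one_add_axis hji hkj.symm hki.symm])
    rw [sub_one_add_axis hji hkj.symm hki.symm] at hlfree
    have hai : ¬ (a : ℤ × ℤ × ℤ) ≤ h - axis i := fun hle =>
      not_axis_le_smul hji.symm s ((sub_le_sub_iff_left h).1 (hs ▸ hle))
    have hifree := hy.mem_freeOf a _ hi hiD hai
    have hikfree := hy.mem_freeOf a _ hikH (hy.lower (sub_axis_lt _ k).le hiD) fun hle =>
      hai (hle.trans (sub_axis_lt _ k).le)
    have hreg : IsRegularMod (y (h - axis i - axis k) * l) (y (h - axis i)) :=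
      (ih _ (sub_one_le_sub_axis h i) (sub_axis_lt h i) hiD k hikH).mul (hlreg _ hi hiD)
    refine IsRegularMod.symm ?_ (hy.ne_zero _ hi hiD)
    convert IsRegularMod.add_of_graded (degreeIn R a) hifree (mul_mem_degreeIn_one hikfree hl)
      hlfree hreg using 1
    ring

theorem dvd_cubeNum_add_one [IsDomain R] (hy : IsLaurentCube H D c y) {h : ℤ × ℤ × ℤ} (hh : h ∈ H)
    (hD : Set.Iio (h + 1) ⊆ D) : y h ∣ cubeNum (C ∘ c) y (h + 1) := by
  have hhD : h ∈ D := hD (lt_add_of_pos_right h zero_lt_one)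
  by_cases h1 : h - 1 ∈ H
  · have hreg : IsRegularMod (∏ i, y (h - axis i)) (y h) := .prod fun i _ =>
      hy.isRegularMod_sub_axis h hh hhD i (hy.upper (sub_one_le_sub_axis h i) h1)
    refine hreg _ ?_
    have h0 := (hy.isCubeOn.map (Ideal.Quotient.mk (Ideal.span {y h}))).prod_mul_cubeNum_eq_zero
      hy.upper hD h1 ((Ideal.Quotient.eq_zero_iff_dvd _ _).2 dvd_rfl)
    simp only [← map_cubeNum, Function.comp_apply, ← map_prod, ← map_mul] at h0
    exact (Ideal.Quotient.eq_zero_iff_dvd _ _).1 h0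
  · exact (hy.isUnit_of_mem_cubeInit ⟨hh, h1⟩).dvd

end IsLaurentCube

section CubeCoeff

variable {Y : ℤ × ℤ × ℤ → MvLaurentPolynomial (cubeInit H) CubeCoeff}

theorem IsCubeOn.comp_evalHom {F : Type*} [Field F] (hY : IsCubeOn H D (C ∘ MvPolynomial.X) Y)
    (φ : CubeCoeff →+* F) {x : cubeInit H → F} (hx : ∀ a, x a ≠ 0) :
    IsCubeOn H D (φ ∘ MvPolynomial.X) (evalHom φ x hx ∘ Y) := by
  convert hY.map (evalHom φ x hx) using 1
  ext i
  exact (evalHom_C φ hx _).symm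

theorem IsCubeOn.evalHom_pos (hup : IsUpperSet H) (hwf : H.IsWF) (hD : IsLowerSet D)
    (hinit : ∀ a : cubeInit H, Y a = X a) (hY : IsCubeOn H D (C ∘ MvPolynomial.X) Y)
    {v : Fin 3 → ℚ} (hv : ∀ i, 0 ≤ v i) (hv' : ∃ i, 0 < v i) {h : ℤ × ℤ × ℤ} (hh : h ∈ H)
    (hhD : h ∈ D) : 0 < evalHom (MvPolynomial.eval₂Hom (Int.castRingHom ℚ) v)
      (fun _ => 1) (fun _ => one_ne_zero) (Y h) := by
  refine (hY.comp_evalHom _ _).pos hup hwf hD (by simpa using hv) (by simpa using hv') ?_ h hh hhD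
  intro a ha
  rw [Function.comp_apply, hinit ⟨a, ha⟩, evalHom_X]
  exact one_pos

theorem IsCubeOn.isLaurentCube (hup : IsUpperSet H) (hwf : H.IsWF) (hD : IsLowerSet D)
    (hinit : ∀ a : cubeInit H, Y a = X a) (hY : IsCubeOn H D (C ∘ MvPolynomial.X) Y) :
    IsLaurentCube H D MvPolynomial.X Y where
  upper := hup
  wf := hwf
  lower := hD
  initial := hinit
  isCubeOn := hY
  ne_zero h hh hhD h0 := by
    have hpos := hY.evalHom_pos hup hwf hD hinit (v := 1) (fun _ => zero_le_one)
      ⟨0, one_pos⟩ hh hhD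
    exact hpos.ne' (by rw [h0, map_zero])
  regular h hh hhD i := by
    have hprime : Prime (C (MvPolynomial.X i) : MvLaurentPolynomial (cubeInit H) CubeCoeff) :=
      prime_C MvPolynomial.X_prime
    refine (IsRegularMod.of_prime hprime fun ⟨q, hq⟩ => ?_).symm hprime.ne_zero
    -- at `α_i = 0` the other two coefficients still keep the array positive
    obtain ⟨j, hji⟩ := exists_ne i
    have hpos := hY.evalHom_pos hup hwf hD hinit (v := Function.update 1 i 0)
      (fun k => by by_cases hk : k = i <;> simp [hk]) ⟨j, by simp [hji]⟩ hh hhD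
    rw [hq, map_mul, evalHom_C, MvPolynomial.eval₂Hom_X', Function.update_self, zero_mul] at hpos
    exact hpos.false

theorem isCubeOn_univ (hup : IsUpperSet H) (hwf : H.IsWF) (hinit : ∀ a : cubeInit H, Y a = X a)
    (hrec : ∀ h, h - 1 ∈ H → Y (h - 1) ∣ cubeNum (C ∘ MvPolynomial.X) Y h →
      Y h * Y (h - 1) = cubeNum (C ∘ MvPolynomial.X) Y h) :
    IsCubeOn H Set.univ (C ∘ MvPolynomial.X) Y := by
  have mem_H : ∀ {h}, h - 1 ∈ H → h ∈ H := fun h1 => hup (sub_one_lt_self _).le h1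
  suffices ∀ h ∈ H, h - 1 ∈ H → Y h * Y (h - 1) = cubeNum (C ∘ MvPolynomial.X) Y h from
    fun h _ h1 => this h (mem_H h1) h1
  refine fun h hh => Set.WellFoundedOn.induction hwf hh fun h _ ih h1 => hrec h h1 ?_
  have hY : IsLaurentCube H (Set.Iio h) MvPolynomial.X Y :=
    IsCubeOn.isLaurentCube hup hwf (isLowerSet_Iio h) hinit fun k hk hk1 => ih k (mem_H hk1) hk hk1
  simpa only [sub_add_cancel] using
    hY.dvd_cubeNum_add_one h1 (by rw [sub_add_cancel])

theorem exists_isLaurentCube (hup : IsUpperSet H) (hwf : H.IsWF) :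
    ∃ Y : ℤ × ℤ × ℤ → MvLaurentPolynomial (cubeInit H) CubeCoeff,
      IsLaurentCube H Set.univ MvPolynomial.X Y := by
  obtain ⟨Y, hinit, hrec⟩ := exists_cube_of_dvd hup hwf (C ∘ MvPolynomial.X)
    (X : cubeInit H → MvLaurentPolynomial (cubeInit H) CubeCoeff)
  exact ⟨Y, (isCubeOn_univ hup hwf hinit hrec).isLaurentCube hup hwf isLowerSet_univ hinit⟩

theorem cubeVar_ne_zero (a : cubeInit H) : cubeVar H a ≠ 0 :=
  (map_ne_zero_iff _ (IsFractionRing.injective _ _)).2 (MvPolynomial.X_ne_zero a)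

theorem evalHom_cubeVar_injective :
    Function.Injective (evalHom (cubeCoeffMap H) (cubeVar H) cubeVar_ne_zero) := by
  have : MvPolynomial.eval₂Hom (cubeCoeffMap H) (cubeVar H) = algebraMap _ (CubeField H) :=
    MvPolynomial.ringHom_ext (fun r => by simp [cubeCoeffMap]) fun a => by simp [cubeVar]
  refine evalHom_injective cubeVar_ne_zero ?_
  rw [this]
  exact IsFractionRing.injective _ _

theorem IsLaurentCube.isCubeArray (hY : IsLaurentCube H Set.univ MvPolynomial.X Y) :
    IsCubeArray H (cubeCoeffMap H (MvPolynomial.X 0)) (cubeCoeffMap H (MvPolynomial.X 1))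
      (cubeCoeffMap H (MvPolynomial.X 2))
      (evalHom (cubeCoeffMap H) (cubeVar H) cubeVar_ne_zero ∘ Y) := by
  refine (isCubeArray_iff hY.upper).2 ⟨fun h hh => ?_, ?_⟩
  · exact (map_ne_zero_iff _ evalHom_cubeVar_injective).2 (hY.ne_zero h hh trivial)
  · convert hY.isCubeOn.comp_evalHom (cubeCoeffMap H) cubeVar_ne_zero using 1
    ext i
    fin_cases i <;> rfl

theorem IsLaurentCube.eq_evalAt {F : Type*} [Field F] {α β γ : F} {y : ℤ × ℤ × ℤ → F}
    (hY : IsLaurentCube H Set.univ MvPolynomial.X Y) (hy : IsCubeArray H α β γ y) :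
    ∀ h ∈ H, y h = (Y h).evalAt (MvPolynomial.eval₂Hom (Int.castRingHom F) ![α, β, γ])
      fun a : cubeInit H => y a := by
  obtain ⟨ne_zero, hcube⟩ := (isCubeArray_iff hY.upper).1 hy
  have hx : ∀ a : cubeInit H, y a ≠ 0 := fun a => ne_zero a a.2.1
  have heval := hY.isCubeOn.comp_evalHom
    (MvPolynomial.eval₂Hom (Int.castRingHom F) ![α, β, γ]) hx
  have hcoeff : MvPolynomial.eval₂Hom (Int.castRingHom F) ![α, β, γ] ∘ MvPolynomial.X =
      ![α, β, γ] := funext fun i => MvPolynomial.eval₂Hom_X' _ _ i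
  rw [hcoeff] at heval
  intro h hh
  rw [← evalHom_apply _ hx]
  refine hcube.eq_of_eq_init hY.upper hY.wf heval ne_zero (fun a ha => ?_) h hh
  rw [Function.comp_apply, hY.initial ⟨a, ha⟩, evalHom_X]

end CubeCoeff

end LaurentPhenomenon

end

theorem theorem1p1 (H : Set (ℤ × ℤ × ℤ)) (hne : H.Nonempty) (hup : IsUpperSet H)
    (hfin : ∀ h ∈ H, (H ∩ Set.Iic h).Finite) :
    ∃ L : H → MvLaurentPolynomial (cubeInit H) CubeCoeff,
      -- the generic array, whose initial entries are independent variables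
      (∃ y : ℤ × ℤ × ℤ → CubeField H,
        IsCubeArray H (cubeCoeffMap H (MvPolynomial.X 0)) (cubeCoeffMap H (MvPolynomial.X 1))
          (cubeCoeffMap H (MvPolynomial.X 2)) y ∧
        (∀ a : cubeInit H, y a = cubeVar H a) ∧
        ∀ h : H, y h = (L h).evalAt (cubeCoeffMap H) (cubeVar H)) ∧
      -- every array that satisfies the recurrence, over every field
      ∀ (F : Type*) [Field F] (α β γ : F) (y : ℤ × ℤ × ℤ → F), IsCubeArray H α β γ y →
        ∀ h : H, y h =
          (L h).evalAt (MvPolynomial.eval₂Hom (Int.castRingHom F) ![α, β, γ])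
            (fun a : cubeInit H => y a) := by
  obtain ⟨Y, hY⟩ := exists_isLaurentCube hup (isWF_of_finite_inter_Iic hfin)
  refine ⟨fun h => Y h, ⟨_, hY.isCubeArray, fun a => ?_, fun h => ?_⟩,
    fun F _ α β γ y hy h => hY.eq_evalAt hy h h.2⟩
  · rw [Function.comp_apply, hY.initial, MvLaurentPolynomial.evalHom_X]
  · exact MvLaurentPolynomial.evalHom_apply _ _ _
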